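/- Let $(R,\mathfrak m)$ be a $2$-dimensional (Noetherian) Cohen–Macaulay local ring, and write $\lambda$ for length. Let $\mathcal F=\{I_n\}_{n\ge 0}$ be a Hilbert filtration of $R$: a decreasing chain of ideals $R=I_0\supseteq I_1\supseteq\cdots$ such that $I_nI_m\subseteq I_{n+m}$ for all $n,m\ge 0$, $I_1I_n=I_{n+1}$ for all $n\gg 0$, and $I_1$ is $\mathfrak m$-primary. Let $K$ be an ideal with $I_{n+1}\subseteq KI_n$ for all $n\ge 0$. For $n\ge 0$ put $$rr_K(I_n)=\bigcup_{k\ge 1}\bigl(KI_{n+k}:I_1^k\bigr).$$ Let $J=(x,y)$ be a minimal reduction of $I_1$. Then the lengths of $R/I_n$, $R/KI_n$, $R/rr_K(I_n)$ ($n\ge0$) are finite; for $n\ge1$ one has $J\,rr_K(I_{n-1})\subseteq rr_K(I_n)$, with quotient of finite length; and there are unique integers $e_0,e_1,e_2$ and $g_0,g_1,g_2$ such that, for $n\gg 0$, $$\lambda(R/I_n)=e_0\binom{n+1}{2}-e_1n+e_2,\qquad \lambda(R/KI_n)=P_K(\mathcal F,n):=g_0\binom{n+1}{2}-g_1n+g_2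 .$$ Moreover $\lambda(R/rr_K(I_n))=P_K(\mathcal F,n)$ for $n\gg 0$, and the following hold. 1. For all $n\ge 2$, $$\Delta^2\bigl[P_K(\mathcal F,n)-\lambda(R/rr_K(I_n))\bigr]=\lambda\left(\frac{rr_K(I_n)}{J\,rr_K(I_{n-1})}\right),$$ where $\Delta^2f(n)=f(n)-2f(n-1)+f(n-2)$. 2. Set $v_0=e_0-\lambda(R/rr_K(I_0))$, $v_1=e_0-\lambda(R/rr_K(I_1))+2\lambda(R/rr_K(I_0))$ and $v_n=\lambda\bigl(rr_K(I_n)/J\,rr_K(I_{n-1})\bigr)$ for $n\ge 2$. Then $v_n=0$ for all but finitely many $n$, and $$g_1=\sum_{n\ge 1}v_n-\lambda(R/rr_K(I_0)),\qquad g_2=\sum_{n\ge 1}(n-1)v_n+\lambda(R/rr_K(I_0)).$$ -/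

import Mathlib

/-- A Noetherian local ring is Cohen-Macaulay if its maximal ideal contains an `R`-regular sequence
whose length is the Krull dimension of `R` (that is, depth equals dimension). -/
structure IsCohenMacaulayLocal (R : Type*) [CommRing R] [IsLocalRing R] : Prop where
  noetherian : IsNoetherianRing R
  exists_regular : ∃ rs : List R, (∀ r ∈ rs, r ∈ IsLocalRing.maximalIdeal R) ∧
    RingTheory.Sequence.IsRegular R rs ∧ (rs.length : WithBot ℕ∞) = ringKrullDim R

/-- A Hilbert filtration of a local ring `R`: a decreasing chain of ideals
`R = I 0 ⊇ I 1 ⊇ I 2 ⊇ ...` which is multiplicative, such that `I 1` is primary to the maximal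
ideal and `I 1 * I n = I (n + 1)` for all large `n`. -/
structure HilbertFiltration (R : Type*) [CommRing R] [IsLocalRing R] where
  I : ℕ → Ideal R
  zero_eq : I 0 = ⊤
  anti : ∀ n, I (n + 1) ≤ I n
  mul_le : ∀ n m, I n * I m ≤ I (n + m)
  good : ∃ p, ∀ n, p ≤ n → I 1 * I n = I (n + 1)
  radical_one : (I 1).radical = IsLocalRing.maximalIdeal R

/-- `J` is a reduction of the ideal `I`: `J ⊆ I` and `J I ^ n = I ^ (n + 1)` for some `n`. -/
def IsReductionOf {R : Type*} [CommRing R] (J I : Ideal R) : Prop :=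
  J ≤ I ∧ ∃ n : ℕ, J * I ^ n = I ^ (n + 1)

/-- `J` is a minimal reduction of `I`: minimal with respect to inclusion among the reductions. -/
def IsMinimalReductionOf {R : Type*} [CommRing R] (J I : Ideal R) : Prop :=
  Minimal (fun J' : Ideal R => IsReductionOf J' I) J

namespace HilbertFiltration

variable {R : Type*} [CommRing R] [IsLocalRing R]

/-- The ideal `K I_{n+k} : I_1 ^ k`. -/
def colonTerm (F : HilbertFiltration R) (K : Ideal R) (n k : ℕ) : Ideal R :=
  Submodule.colon (K * F.I (n + k)) ((F.I 1 ^ k : Ideal R) : Set R)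

theorem colonTerm_mono (F : HilbertFiltration R) (K : Ideal R) (n : ℕ) :
    Monotone (F.colonTerm K n) := by
  refine monotone_nat_of_le_succ fun k x hx => ?_
  rw [colonTerm, Submodule.mem_colon] at hx ⊢
  intro s hs
  rw [SetLike.mem_coe, pow_succ] at hs
  induction hs using Submodule.mul_induction_on' with
  | mem_mul_mem a ha b hb =>
    have h1 : x • a * b ∈ K * F.I (n + k) * F.I 1 := Ideal.mul_mem_mul (hx a ha) hb
    have h2 : K * F.I (n + k) * F.I 1 ≤ K * F.I (n + (k + 1)) := by
      rw [mul_assoc]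
      exact Ideal.mul_mono_right (F.mul_le (n + k) 1)
    simpa [smul_eq_mul, mul_assoc] using h2 h1
  | add a _ b _ ha hb => rw [smul_add]; exact add_mem ha hb

/-- The Ratliff-Rush closure of the filtration with respect to `K`, in degree `n`: the ideal
`rr_K(I_n) = ⋃_{k ≥ 1} (K I_{n+k} : I_1 ^ k)`. -/
def rr (F : HilbertFiltration R) (K : Ideal R) (n : ℕ) : Ideal R where
  carrier := {x | ∃ k, 1 ≤ k ∧ x ∈ F.colonTerm K n k}
  zero_mem' := ⟨1, le_rfl, zero_mem _⟩
  add_mem' := by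
    rintro a b ⟨k, hk, ha⟩ ⟨l, _, hb⟩
    exact ⟨max k l, le_max_of_le_left hk,
      add_mem (F.colonTerm_mono K n (le_max_left k l) ha)
        (F.colonTerm_mono K n (le_max_right k l) hb)⟩
  smul_mem' := by
    rintro c a ⟨k, hk, ha⟩
    exact ⟨k, hk, Submodule.smul_mem _ c ha⟩

end HilbertFiltration

/-- The quotient module `A / B` of two ideals (meant for `B ⊆ A`). -/
abbrev IdealQuot {R : Type*} [CommRing R] (A B : Ideal R) : Type _ :=
  A ⧸ Submodule.submoduleOf B A

/-- The length `λ(M)` of a module, as a natural number (meaningful if the length is finite). -/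
noncomputable def lam (R M : Type*) [CommRing R] [AddCommGroup M] [Module R M] : ℕ :=
  (Module.length R M).toNat

/-- The polynomial `c₀ (n+1 choose 2) - c₁ (n choose 1) + c₂`, i.e. the polynomial with
(normalized, signed) Hilbert coefficients `c₀, c₁, c₂` in dimension `2`. -/
def hilbertPoly (c : Fin 3 → ℤ) (n : ℕ) : ℤ :=
  c 0 * ((n + 1).choose 2 : ℤ) - c 1 * (n.choose 1 : ℤ) + c 2

/-- `c₀, c₁, c₂` are the Hilbert coefficients of `H`: the polynomial `hilbertPoly c` agrees with
`H n` for all large `n`. -/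
def HasHilbertCoeffs (H : ℕ → ℕ) (c : Fin 3 → ℤ) : Prop :=
  ∀ᶠ n in Filter.atTop, (H n : ℤ) = hilbertPoly c n

/-- The second backward difference `Δ² f (n) = f (n) - 2 f (n - 1) + f (n - 2)`
(used for `n ≥ 2` only). -/
def backwardDiff2 (f : ℕ → ℤ) (n : ℕ) : ℤ :=
  f n - 2 * f (n - 1) + f (n - 2)

/-- The numbers `v_n`, where `e0` stands for `e_0(F)`. -/
noncomputable def vSeq {R : Type*} [CommRing R] [IsLocalRing R] (F : HilbertFiltration R)
    (K J : Ideal R) (e0 : ℤ) : ℕ → ℤ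
  | 0 => e0 - lam R (R ⧸ F.rr K 0)
  | 1 => e0 - lam R (R ⧸ F.rr K 1) + 2 * (lam R (R ⧸ F.rr K 0) : ℤ)
  | n + 2 => lam R (IdealQuot (F.rr K (n + 2)) (J * F.rr K (n + 1)))

/-! The engine is one length identity. If `x, y` is a regular pair and `J = (x, y)`, the Koszul
relations give, for every ideal `A`, an exact sequence 0 → R/(A : J) → (R/A)² → J/JA → 0, so λ(R/JA)
+ λ(R/(A : J)) = λ(R/J) + 2λ(R/A) (`IsRegularPair.length_add_length`). For `A = rr_K(I_{n+1})` one
has `A : J = rr_K(I_n)` in every degree (`colon_rr_succ`), so λ(rr_K(I_{n+2}) / J rr_K(I_{n+1})) is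
λ(R/J) minus the second difference of λ(R/rr_K(I_n)). For `A = K I_{n+1}` with n large, Artin–Rees
gives `A : J = K I_n`, while `JA = K I_{n+2}`. Hence λ(R/K I_n) eventually has constant second
difference λ(R/J), and rr_K(I_n) = K I_n for large n. Taking K = R as well shows e₀ = g₀ = λ(R/J).
The formulas for g₁ and g₂ follow by telescoping. -/

/-! ### Regular pairs of elements -/

section RegularPair

variable {R : Type*} [CommRing R]

/-- `x, y` is a weakly regular sequence on `R`, in elementwise form. -/
structure IsRegularPair (x y : R) : Prop where
  left : ∀ z, x * z = 0 → z = 0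
  right : ∀ a b, y * a = x * b → ∃ t, a = x * t

theorem IsRegularPair.pow_right {x y : R} (h : IsRegularPair x y) (n : ℕ) :
    IsRegularPair x (y ^ n) := by
  refine ⟨h.left, ?_⟩
  induction n with
  | zero => exact fun a b hab => ⟨b, by simpa using hab⟩
  | succ n ih =>
    intro a b hab
    obtain ⟨t, ht⟩ := h.right (y ^ n * a) b (by rw [← hab]; ring)
    exact ih a t ht

theorem IsRegularPair.pow_left {x y : R} (h : IsRegularPair x y) (n : ℕ) :
    IsRegularPair (x ^ n) y := by
  induction n with
  | zero => exact ⟨fun z hz => by simpa using hz, fun a _ _ => ⟨a, by simp⟩⟩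
  | succ n ih =>
    refine ⟨fun z hz => ih.left z (h.left _ (by rw [← hz]; ring)), fun a b hab => ?_⟩
    obtain ⟨t, rfl⟩ := h.right a (x ^ n * b) (by rw [hab]; ring)
    have h1 : x * (y * t - x ^ n * b) = 0 := by linear_combination hab
    obtain ⟨s, rfl⟩ := ih.right t b (sub_eq_zero.mp (h.left _ h1))
    exact ⟨s, by ring⟩

theorem IsRegularPair.syzygy {x y : R} (h : IsRegularPair x y) {a b : R}
    (hab : x * a + y * b = 0) : ∃ r, a = -(y * r) ∧ b = x * r := by
  obtain ⟨r, rfl⟩ := h.right b (-a) (by linear_combination hab)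
  refine ⟨r, ?_, rfl⟩
  have h1 : x * (a + y * r) = 0 := by linear_combination hab
  exact eq_neg_of_add_eq_zero_left (h.left _ h1)

/-- Any two elements generating an ideal that contains powers of a regular pair form a regular
pair. -/
theorem IsRegularPair.of_pow_mem [IsNoetherianRing R] [IsLocalRing R] {a b x y : R} {k : ℕ}
    (hab : IsRegularPair a b)
    (hk : IsLocalRing.maximalIdeal R ^ k ≤ Ideal.span {x, y})
    (ha : a ∈ IsLocalRing.maximalIdeal R) (hb : b ∈ IsLocalRing.maximalIdeal R)
    (hy : y ∈ IsLocalRing.maximalIdeal R) : IsRegularPair x y := by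
  have hAB : IsRegularPair (a ^ k) (b ^ k) := (hab.pow_left k).pow_right k
  obtain ⟨p, q, hpq⟩ := Ideal.mem_span_pair.mp (hk (Ideal.pow_mem_pow ha k))
  obtain ⟨r, s, hrs⟩ := Ideal.mem_span_pair.mp (hk (Ideal.pow_mem_pow hb k))
  generalize a ^ k = A at *
  generalize b ^ k = B at *
  have key : ∀ z, x * z = 0 → y * z = 0 → z = 0 := fun z h1 h2 =>
    hAB.left z (by rw [← hpq]; linear_combination p * h1 + q * h2)
  have hx : ∀ z, x * z = 0 → z = 0 := by
    let Z : Ideal R := Submodule.colon ⊥ {x}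
    have memZ : ∀ z, z ∈ Z ↔ x * z = 0 := fun z => by
      simp [Z, Submodule.mem_colon_singleton, mul_comm]
    -- Aim at Nakayama for Z = (0 : x). If xz = 0, then Az = yqz and Bz = ysz, so Bqz - Asz is
    -- killed by both x and y, hence by A, and vanishes. Regularity of A, B gives qz = Aw, whence xw
    -- = 0 and z = yw.
    have hle : Z ≤ Ideal.span {y} • Z := by
      intro z hz
      rw [memZ] at hz
      have h1 : y * (B * (q * z) - A * (s * z)) = 0 := by
        rw [← hpq, ← hrs]; linear_combination (q * y * r - s * y * p) * hz
      have h2 : x * (B * (q * z) - A * (s * z)) = 0 := by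
        linear_combination (B * q - A * s) * hz
      obtain ⟨w, hw⟩ := hAB.right (q * z) (s * z) (sub_eq_zero.mp (key _ h2 h1))
      have hwZ : w ∈ Z := by
        rw [memZ]
        apply hAB.left
        linear_combination (-x) * hw + q * hz
      have hzw : z = y * w := by
        apply sub_eq_zero.mp
        apply hAB.left
        linear_combination y * hw - z * hpq + p * hz
      rw [hzw]
      exact Submodule.smul_mem_smul (Ideal.mem_span_singleton_self y) hwZ
    have hbot : Z = ⊥ := by
      refine Submodule.eq_bot_of_le_smul_of_le_jacobson_bot (Ideal.span {y}) Z
        (IsNoetherian.noetherian Z) hle ?_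
      rw [IsLocalRing.jacobson_eq_maximalIdeal ⊥ bot_ne_top, Ideal.span_singleton_le_iff_mem]
      exact hy
    intro z hz
    simpa [hbot] using (memZ z).mpr hz
  refine ⟨hx, fun c d hcd => ?_⟩
  -- From yc = xd, x(pc + qd) = Ac and x(rc + sd) = Bc. Cancelling x makes A divide pc + qd, say
  -- with quotient t; cancelling A in Ac = xAt gives c = xt.
  have h1 : x * (B * (p * c + q * d) - A * (r * c + s * d)) = 0 := by
    linear_combination (A * s - B * q) * hcd + B * c * hpq - A * c * hrs
  obtain ⟨t, ht⟩ := hAB.right _ _ (sub_eq_zero.mp (hx _ h1))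
  refine ⟨t, sub_eq_zero.mp (hAB.left _ ?_)⟩
  linear_combination q * hcd + x * ht - c * hpq

end RegularPair

/-! ### Lengths of quotients and the Koszul length identity -/

section Length

variable {R : Type*} [CommRing R]

theorem length_quotient_eq_add {A B : Ideal R} (h : B ≤ A) :
    Module.length R (R ⧸ B) = Module.length R (IdealQuot A B) + Module.length R (R ⧸ A) := by
  refine Module.length_eq_add_of_exact
    (Submodule.liftQ (Submodule.submoduleOf B A) (B.mkQ ∘ₗ A.subtype) ?_)
    (Submodule.factor h) ?_ (Submodule.factor_surjective h) ?_
  · intro a ha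
    rwa [LinearMap.mem_ker, LinearMap.comp_apply, Submodule.mkQ_apply,
      Submodule.Quotient.mk_eq_zero]
  · rw [← LinearMap.ker_eq_bot, Submodule.ker_liftQ_eq_bot']
    ext a
    rw [LinearMap.mem_ker, LinearMap.comp_apply, Submodule.mkQ_apply,
      Submodule.Quotient.mk_eq_zero]
    rfl
  · rw [LinearMap.exact_iff, Submodule.range_liftQ]
    ext z
    obtain ⟨z, rfl⟩ := Submodule.mkQ_surjective _ z
    rw [LinearMap.mem_ker, show Submodule.factor h (B.mkQ z) = A.mkQ z from rfl,
      Submodule.mkQ_apply A, Submodule.Quotient.mk_eq_zero]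
    constructor
    · intro hz
      exact ⟨⟨z, hz⟩, rfl⟩
    · rintro ⟨a, ha⟩
      have h1 : (a : R) - z ∈ B := (Submodule.Quotient.eq B).mp ha
      simpa using sub_mem a.2 (h h1)

theorem length_quotient_ne_top_of_le {A B : Ideal R} (h : B ≤ A)
    (hB : Module.length R (R ⧸ B) ≠ ⊤) : Module.length R (R ⧸ A) ≠ ⊤ :=
  ne_top_of_le_ne_top hB
    (Module.length_le_of_surjective (Submodule.factor h) (Submodule.factor_surjective h))

theorem length_idealQuot_ne_top {A B : Ideal R} (h : B ≤ A)
    (hB : Module.length R (R ⧸ B) ≠ ⊤) : Module.length R (IdealQuot A B) ≠ ⊤ := by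
  rw [length_quotient_eq_add h] at hB
  exact fun h' => hB (by rw [h', top_add])

theorem lam_quotient_eq_add {A B : Ideal R} (h : B ≤ A)
    (hB : Module.length R (R ⧸ B) ≠ ⊤) :
    lam R (R ⧸ B) = lam R (IdealQuot A B) + lam R (R ⧸ A) := by
  rw [lam, length_quotient_eq_add h, ENat.toNat_add (length_idealQuot_ne_top h hB)
    (length_quotient_ne_top_of_le h hB)]
  rfl

theorem length_quotient_ne_top_of_maximalIdeal_pow_le [IsNoetherianRing R] [IsLocalRing R]
    {A : Ideal R} {k : ℕ} (h : IsLocalRing.maximalIdeal R ^ k ≤ A) :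
    Module.length R (R ⧸ A) ≠ ⊤ := by
  by_cases hA : A = ⊤
  · have : Subsingleton (R ⧸ A) := Ideal.Quotient.subsingleton_iff.mpr hA
    simp [Module.length_eq_zero]
  have : Nontrivial (R ⧸ A) := Ideal.Quotient.nontrivial_iff.mpr hA
  have : IsLocalRing (R ⧸ A) :=
    .of_surjective' (Ideal.Quotient.mk A) Ideal.Quotient.mk_surjective
  have : IsArtinianRing (R ⧸ A) := by
    rw [isArtinianRing_iff_isNilpotent_maximalIdeal]
    refine ⟨k, ?_⟩
    rw [← IsLocalRing.map_maximalIdeal_of_surjective (Ideal.Quotient.mk A)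
      Ideal.Quotient.mk_surjective, ← Ideal.map_pow, Submodule.zero_eq_bot, Ideal.map_eq_bot_iff_le_ker,
      Ideal.mk_ker]
    exact h
  rw [Module.length_eq_of_surjective (S := R) (R := R ⧸ A) (M := R ⧸ A)
    Ideal.Quotient.mk_surjective]
  exact Module.length_ne_top

/-- Additivity of length along R/(A : J) → (R/A)² → R/JA → R/J, with maps r ↦ (-yr, xr) and (a, b) ↦
xa + yb. Exactness at (R/A)² is where regularity enters, through `IsRegularPair.syzygy`. -/
theorem IsRegularPair.length_add_length {x y : R} (h : IsRegularPair x y) (A : Ideal R) :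
    Module.length R (R ⧸ Ideal.span {x, y} * A)
        + Module.length R (R ⧸ Submodule.colon A (Ideal.span {x, y} : Set R))
      = Module.length R (R ⧸ Ideal.span {x, y}) + 2 * Module.length R (R ⧸ A) := by
  set J := Ideal.span {x, y} with hJ
  have hxJ : x ∈ J := Ideal.subset_span (by simp)
  have hyJ : y ∈ J := Ideal.subset_span (by simp)
  let C := Submodule.colon A (J : Set R)
  have memC : ∀ r, r ∈ C ↔ x * r ∈ A ∧ y * r ∈ A := by
    intro r
    rw [Submodule.mem_colon]
    refine ⟨fun hr => ⟨by simpa [mul_comm] using hr x hxJ, by simpa [mul_comm] using hr y hyJ⟩,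
      fun hr s hs => ?_⟩
    obtain ⟨a, b, rfl⟩ := Ideal.mem_span_pair.mp hs
    have : r • (a * x + b * y) = a * (x * r) + b * (y * r) := by rw [smul_eq_mul]; ring
    rw [this]
    exact add_mem (A.mul_mem_left _ hr.1) (A.mul_mem_left _ hr.2)
  let m : R → R →ₗ[R] R := fun r => LinearMap.mulLeft R r
  let f : (R ⧸ C) →ₗ[R] (R ⧸ A) × (R ⧸ A) :=
    (Submodule.mapQ C A (m (-y)) fun r hr => by
      simpa [m] using ((memC r).mp hr).2).prod
    (Submodule.mapQ C A (m x) fun r hr => by simpa [m] using ((memC r).mp hr).1)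
  let g : (R ⧸ A) × (R ⧸ A) →ₗ[R] R ⧸ J * A :=
    (Submodule.mapQ A (J * A) (m x) fun r hr => Ideal.mul_mem_mul hxJ hr).coprod
    (Submodule.mapQ A (J * A) (m y) fun r hr => Ideal.mul_mem_mul hyJ hr)
  have fmk : ∀ r, f (C.mkQ r) = (A.mkQ (-y * r), A.mkQ (x * r)) := fun r => rfl
  have gmk : ∀ a b, g (A.mkQ a, A.mkQ b) = (J * A).mkQ (x * a + y * b) := fun a b => rfl
  have mem0 : ∀ (B : Ideal R) (r : R), B.mkQ r = 0 ↔ r ∈ B := fun B r =>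
    Submodule.Quotient.mk_eq_zero B
  have memJA : ∀ z, z ∈ J * A ↔ ∃ a ∈ A, ∃ b ∈ A, x * a + y * b = z := fun z => by
    rw [hJ, Ideal.span_insert, Ideal.sup_mul, Submodule.mem_sup]
    simp [Ideal.mem_span_singleton_mul]
  have hf : Function.Injective f := by
    rw [← LinearMap.ker_eq_bot, LinearMap.ker_eq_bot']
    intro r hr
    obtain ⟨r, rfl⟩ := C.mkQ_surjective r
    rw [fmk, Prod.mk_eq_zero, mem0, mem0] at hr
    rw [mem0, memC]
    exact ⟨hr.2, by simpa using hr.1⟩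
  have hfg : Function.Exact f g := by
    rintro ⟨a, b⟩
    obtain ⟨a, rfl⟩ := A.mkQ_surjective a
    obtain ⟨b, rfl⟩ := A.mkQ_surjective b
    rw [gmk, mem0, memJA]
    constructor
    · rintro ⟨a', ha', b', hb', hz⟩
      obtain ⟨r, h1, h2⟩ := h.syzygy (a := a - a') (b := b - b') (by linear_combination -hz)
      refine ⟨C.mkQ r, ?_⟩
      rw [fmk, Prod.mk.injEq, ← sub_eq_zero, ← map_sub, mem0, ← sub_eq_zero (a := A.mkQ (x * r)),
        ← map_sub, mem0]
      constructor
      · have : -y * r - a = -a' := by linear_combination -h1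
        rw [this]; exact neg_mem ha'
      · have : x * r - b = -b' := by linear_combination -h2
        rw [this]; exact neg_mem hb'
    · rintro ⟨r, hr⟩
      obtain ⟨r, rfl⟩ := C.mkQ_surjective r
      rw [fmk, Prod.mk.injEq, ← sub_eq_zero, ← map_sub, mem0, ← sub_eq_zero (a := A.mkQ (x * r)),
        ← map_sub, mem0] at hr
      refine ⟨_, neg_mem hr.1, _, neg_mem hr.2, by ring⟩
  have hJA : J * A ≤ J := Ideal.mul_le_left
  have hgr : Function.Exact g.range.subtype (Submodule.factor hJA) := by
    intro z
    obtain ⟨z, rfl⟩ := (J * A).mkQ_surjective z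
    rw [show Submodule.factor hJA ((J * A).mkQ z) = J.mkQ z from rfl, mem0]
    simp only [Submodule.coe_subtype, Subtype.range_coe_subtype, SetLike.setOfPred_mem_eq,
      SetLike.mem_coe]
    constructor
    · intro hz
      obtain ⟨a, b, rfl⟩ := Ideal.mem_span_pair.mp hz
      exact ⟨(A.mkQ a, A.mkQ b), by rw [gmk, mul_comm x, mul_comm y]⟩
    · rintro ⟨⟨a, b⟩, hab⟩
      obtain ⟨a, rfl⟩ := A.mkQ_surjective a
      obtain ⟨b, rfl⟩ := A.mkQ_surjective b
      rw [gmk, ← sub_eq_zero, ← map_sub, mem0] at hab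
      have h1 := hJA hab
      have h2 : x * a + y * b ∈ J := add_mem (J.mul_mem_right _ hxJ) (J.mul_mem_right _ hyJ)
      simpa using sub_mem h2 h1
  have e1 := Module.length_eq_add_of_exact f g.rangeRestrict hf g.surjective_rangeRestrict
    (fun z => by rw [← hfg z]; simp [Subtype.ext_iff])
  have e2 := Module.length_eq_add_of_exact g.range.subtype (Submodule.factor hJA)
    (Submodule.injective_subtype _) (Submodule.factor_surjective hJA) hgr
  rw [Module.length_prod, ← two_mul] at e1
  rw [e2, e1]
  change _ + _ + Module.length R (R ⧸ C) = _
  ring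

end Length

/-! ### Colons in stable filtrations -/

section StableFiltration

variable {R : Type*} [CommRing R]

/-- If `M` is a decreasing `J`-stable filtration by ideals, where `J` contains a nonzerodivisor
`x`, then `(M (n + 1) : J) = M n` for all large `n`. -/
theorem exists_colon_succ_eq_of_stable [IsNoetherianRing R] {J : Ideal R} {x : R}
    (hxJ : x ∈ J) (hx : ∀ z, x * z = 0 → z = 0) {M : ℕ → Ideal R}
    (anti : ∀ n, M (n + 1) ≤ M n) (hJM : ∀ n, J * M n ≤ M (n + 1)) {n₀ : ℕ}
    (hst : ∀ n, n₀ ≤ n → J * M n = M (n + 1)) :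
    ∃ n₁, ∀ n, n₁ ≤ n → Submodule.colon (M (n + 1)) (J : Set R) = M n := by
  have mono : ∀ n, M n ≤ Submodule.colon (M (n + 1)) (J : Set R) := fun n z hz => by
    rw [Submodule.mem_colon]
    intro s hs
    rw [smul_eq_mul, mul_comm]
    exact hJM n (Ideal.mul_mem_mul hs hz)
  -- The colons form a J-filtration. Once it is bounded by the stable filtration `G`, it is stable
  -- itself, and then (M (n+2) : J) = J (M (n+1) : J) ⊆ M (n+1) for large n.
  let L : J.Filtration R :=
    { N := fun n => Submodule.colon (M (n + 1)) (J : Set R)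
      mono := fun n => Submodule.colon_mono (anti (n + 1)) subset_rfl
      smul_le := fun n => by
        rw [Submodule.smul_le]
        intro j hj z hz
        rw [Submodule.mem_colon] at hz ⊢
        intro s hs
        have := hJM (n + 1) (Ideal.mul_mem_mul hj (hz s hs))
        simpa [mul_assoc] using this }
  -- `c` is the Artin–Rees constant of (x) ⊆ R. If zx ∈ M (n+1) ⊆ J^(n+1-n₀), then zx ∈ J^(n+1-n₀-c)
  -- x, and x cancels; this explains the shift n₀ + c in `G`.
  obtain ⟨c, hc⟩ := J.exists_pow_inf_eq_pow_smul (M := R) (Ideal.span {x})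
  let G : J.Filtration R :=
    { N := fun n => J ^ (n - (n₀ + c))
      mono := fun n => Ideal.pow_le_pow_right (by omega)
      smul_le := fun n => by
        rw [smul_eq_mul, ← pow_succ']
        exact Ideal.pow_le_pow_right (by omega) }
  have hG : G.Stable := ⟨n₀ + c, fun n hn => by
    change J • J ^ (n - (n₀ + c)) = J ^ (n + 1 - (n₀ + c))
    rw [smul_eq_mul, ← pow_succ', Nat.sub_add_comm hn]⟩
  have hpow : ∀ m, M (n₀ + m) ≤ J ^ m := by
    intro m
    induction m with
    | zero => simp
    | succ m ih =>
      rw [← add_assoc, ← hst _ (by omega), pow_succ']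
      exact Ideal.mul_mono_right ih
  have hLG : L ≤ G := by
    intro n z hz
    change z ∈ J ^ (n - (n₀ + c))
    rcases le_or_gt n (n₀ + c) with hn | hn
    · simp [Nat.sub_eq_zero_of_le hn]
    obtain ⟨m, rfl⟩ := Nat.exists_eq_add_of_le hn.le
    have hzx : z * x ∈ M (n₀ + (c + m + 1)) := by
      have := (Submodule.mem_colon.mp hz) x hxJ
      rwa [smul_eq_mul, show n₀ + c + m + 1 = n₀ + (c + m + 1) by ring] at this
    have h1 : z * x ∈ J ^ (c + m + 1) • (⊤ : Submodule R R) ⊓ Ideal.span {x} :=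
      ⟨by simpa using hpow _ hzx, Ideal.mem_span_singleton'.mpr ⟨z, rfl⟩⟩
    rw [hc _ (by omega)] at h1
    have h2 : z * x ∈ J ^ (c + m + 1 - c) * Ideal.span {x} :=
      Ideal.mul_mono_right inf_le_right h1
    obtain ⟨w, hw, hwx⟩ := Ideal.mem_mul_span_singleton.mp h2
    have hwz : w = z := sub_eq_zero.mp (hx _ (by linear_combination hwx))
    rw [← hwz]
    exact Ideal.pow_le_pow_right (by omega) hw
  obtain ⟨n₁, hn₁⟩ := hG.of_le hLG
  refine ⟨n₁ + 1, fun n hn => le_antisymm ?_ (mono n)⟩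
  obtain ⟨n, rfl⟩ := Nat.exists_eq_add_of_le' (Nat.le_of_add_left_le hn)
  change L.N (n + 1) ≤ M (n + 1)
  rw [← hn₁ n (by omega), Submodule.smul_le]
  intro j hj z hz
  rw [smul_eq_mul, mul_comm]
  exact (Submodule.mem_colon.mp hz) j hj

theorem mem_of_forall_mul_pow_mem {J : Ideal R} {M : ℕ → Ideal R} {n₁ : ℕ}
    (h : ∀ n, n₁ ≤ n → Submodule.colon (M (n + 1)) (J : Set R) = M n) (k : ℕ) :
    ∀ n, n₁ ≤ n → ∀ z, (∀ s ∈ J ^ k, z * s ∈ M (n + k)) → z ∈ M n := by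
  induction k with
  | zero => exact fun n _ z hz => by simpa using hz 1 (by simp)
  | succ k ih =>
    intro n hn z hz
    refine ih n hn z fun s hs => ?_
    rw [← h (n + k) (by omega), Submodule.mem_colon]
    intro j hj
    rw [smul_eq_mul, mul_assoc]
    exact hz _ (by rw [pow_succ]; exact Ideal.mul_mem_mul hs hj)

end StableFiltration

/-! ### Hilbert coefficients and summation of second differences -/

section HilbertPolynomial

theorem hilbertPoly_zero (c : Fin 3 → ℤ) : hilbertPoly c 0 = c 2 := by
  simp [hilbertPoly]

theorem hilbertPoly_succ (c : Fin 3 → ℤ) (n : ℕ) :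
    hilbertPoly c (n + 1) = hilbertPoly c n + c 0 * (n + 1) - c 1 := by
  simp only [hilbertPoly, Nat.choose_succ_succ' (n + 1) 1, Nat.choose_one_right]
  push_cast
  ring

theorem exists_hasHilbertCoeffs {H : ℕ → ℕ} {e : ℤ} {N : ℕ}
    (h : ∀ n, N ≤ n → (H (n + 2) : ℤ) - 2 * H (n + 1) + H n = e) :
    ∃ c : Fin 3 → ℤ, c 0 = e ∧ HasHilbertCoeffs H c := by
  -- The last two coefficients are forced by interpolation at N and N + 1; the recurrence does the
  -- rest.
  let c₁ : ℤ := e * (N + 1) - (H (N + 1) - H N)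
  let c : Fin 3 → ℤ := ![e, c₁, H N - e * ((N + 1).choose 2 : ℤ) + c₁ * N]
  refine ⟨c, rfl, Filter.eventually_atTop.mpr ⟨N, ?_⟩⟩
  have h0 : (H N : ℤ) = hilbertPoly c N := by simp [hilbertPoly, c]
  have h1 : (H (N + 1) : ℤ) = hilbertPoly c (N + 1) := by
    rw [hilbertPoly_succ, ← h0]
    simp only [c, c₁, Matrix.cons_val_zero, Matrix.cons_val_one]
    ring
  have key : ∀ m, (H (N + m) : ℤ) = hilbertPoly c (N + m) ∧
      (H (N + m + 1) : ℤ) = hilbertPoly c (N + m + 1) := by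
    intro m
    induction m with
    | zero => exact ⟨h0, h1⟩
    | succ m ih =>
      refine ⟨ih.2, ?_⟩
      have h2 := h (N + m) (by omega)
      have h3 := hilbertPoly_succ c (N + m)
      have h4 := hilbertPoly_succ c (N + m + 1)
      have hc : c 0 = e := rfl
      rw [hc] at h3 h4
      push_cast at h3 h4
      change (H (N + m + 2) : ℤ) = hilbertPoly c (N + m + 1 + 1)
      linear_combination h2 + 2 * ih.2 - ih.1 - h4 + h3
  intro n hn
  obtain ⟨m, rfl⟩ := Nat.exists_eq_add_of_le hn
  exact (key m).1

theorem HasHilbertCoeffs.unique {H : ℕ → ℕ} {c d : Fin 3 → ℤ} (hc : HasHilbertCoeffs H c)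
    (hd : HasHilbertCoeffs H d) : c = d := by
  obtain ⟨N, hN⟩ := Filter.eventually_atTop.mp (hc.and hd)
  have h : ∀ n, N ≤ n → hilbertPoly c n = hilbertPoly d n := fun n hn => by
    rw [← (hN n hn).1, (hN n hn).2]
  have a0 := h N le_rfl
  have a1 := h (N + 1) (by omega)
  have a2 := h (N + 1 + 1) (by omega)
  rw [hilbertPoly_succ, hilbertPoly_succ] at a2
  rw [hilbertPoly_succ, hilbertPoly_succ] at a1
  rw [hilbertPoly_succ, hilbertPoly_succ] at a2
  push_cast at a2
  have e0 : c 0 = d 0 := by linear_combination a2 - 2 * a1 + a0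
  have e1 : c 1 = d 1 := by linear_combination a0 - a1 + (N + 1) * e0
  have e2 : c 2 = d 2 := by
    simp only [hilbertPoly, e0, e1] at a0
    linear_combination a0
  funext i
  fin_cases i <;> assumption

theorem backwardDiff2_hilbertPoly_sub (g : Fin 3 → ℤ) (h : ℕ → ℤ) (n : ℕ) :
    backwardDiff2 (fun m => hilbertPoly g m - h m) (n + 2) =
      g 0 - (h (n + 2) - 2 * h (n + 1) + h n) := by
  simp only [backwardDiff2, Nat.add_sub_cancel,
    show n + 2 - 1 = n + 1 from rfl]
  have h3 := hilbertPoly_succ g n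
  have h4 := hilbertPoly_succ g (n + 1)
  push_cast at h4
  linear_combination h4 - h3

/-- Summation of the second differences of `hilbertPoly g - h`, for a function `h` that agrees
with `hilbertPoly g` for large arguments. -/
theorem hilbertCoeffs_eq_finsum {g : Fin 3 → ℤ} {h v : ℕ → ℤ}
    (hh : ∀ᶠ n in Filter.atTop, h n = hilbertPoly g n)
    (hv₁ : v 1 = g 0 - h 1 + 2 * h 0)
    (hv : ∀ n, v (n + 2) = g 0 - (h (n + 2) - 2 * h (n + 1) + h n)) :
    {n | v n ≠ 0}.Finite ∧
      g 1 = (∑ᶠ (n : ℕ) (_ : 1 ≤ n), v n) - h 0 ∧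
      g 2 = (∑ᶠ (n : ℕ) (_ : 1 ≤ n), ((n : ℤ) - 1) * v n) + h 0 := by
  obtain ⟨N, hN⟩ := Filter.eventually_atTop.mp hh
  let d : ℕ → ℤ := fun n => hilbertPoly g n - h n
  have hd : ∀ n, N ≤ n → d n = 0 := fun n hn => by simp [d, hN n hn]
  have hvd : ∀ n, v (n + 2) = d (n + 2) - 2 * d (n + 1) + d n := fun n => by
    rw [hv, ← backwardDiff2_hilbertPoly_sub]
    rfl
  have hd0 : d 0 = g 2 - h 0 := by simp [d, hilbertPoly_zero]
  -- This is the second difference at 1 with d(-1) = g₁ + g₂: the polynomial takes that value at -1,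
  -- and h(-1) counts as 0.
  have hvd₁ : v 1 = d 1 - 2 * d 0 + (g 1 + g 2) := by
    have := hilbertPoly_succ g 0
    simp only [hilbertPoly_zero, zero_add, Nat.cast_zero] at this
    simp only [d, hilbertPoly_zero]
    linear_combination hv₁ - this
  have hzero : ∀ n, N + 2 ≤ n → v n = 0 := fun n hn => by
    obtain ⟨m, rfl⟩ := Nat.exists_eq_add_of_le' (Nat.le_of_add_left_le hn)
    rw [hvd, hd _ (by omega), hd _ (by omega), hd _ (by omega)]
    ring
  have hsum : ∀ f : ℕ → ℤ, (∀ n, N + 2 ≤ n → f n = 0) →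
      (∑ᶠ (n : ℕ) (_ : 1 ≤ n), f n) = ∑ i ∈ Finset.range (N + 1), f (1 + i) := by
    intro f hf
    rw [show N + 1 = N + 2 - 1 from rfl, ← Finset.sum_Ico_eq_sum_range]
    refine finsum_mem_eq_sum_of_inter_support_eq (s := Set.Ici 1) f ?_
    ext n
    simp only [Set.mem_inter_iff, Set.mem_Ici, Function.mem_support, Finset.coe_Ico, Set.mem_Ico]
    refine ⟨fun ⟨h1, h2⟩ => ⟨⟨h1, ?_⟩, h2⟩, fun ⟨h1, h2⟩ => ⟨h1.1, h2⟩⟩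
    by_contra h3
    exact h2 (hf n (by omega))
  have s1 : ∀ m, ∑ i ∈ Finset.range (m + 1), v (1 + i) = d (m + 1) - d m - d 0 + g 1 + g 2 := by
    intro m
    induction m with
    | zero =>
      simp only [zero_add, Finset.sum_range_one, add_zero]
      linear_combination hvd₁
    | succ m ih =>
      rw [Finset.sum_range_succ, ih, show 1 + (m + 1) = m + 2 by ring, hvd]
      ring_nf
  have s2 : ∀ m : ℕ, ∑ i ∈ Finset.range (m + 1), (((1 + i : ℕ) : ℤ) - 1) * v (1 + i) =
      m * d (m + 1) - (m + 1) * d m + d 0 := by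
    intro m
    induction m with
    | zero => simp
    | succ m ih =>
      rw [Finset.sum_range_succ, ih, show 1 + (m + 1) = m + 2 by ring, hvd]
      push_cast
      ring_nf
  refine ⟨(Set.finite_lt_nat (N + 2)).subset fun n hn => ?_, ?_, ?_⟩
  · by_contra h3
    exact hn (hzero n (not_lt.mp h3))
  · rw [hsum v hzero, s1, hd N le_rfl, hd (N + 1) (by omega)]
    linear_combination hd0
  · rw [hsum (fun n => ((n : ℤ) - 1) * v n) fun n hn => by rw [hzero n hn, mul_zero], s2,
      hd N le_rfl, hd (N + 1) (by omega)]
    linear_combination -hd0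

end HilbertPolynomial

/-! ### Reductions, and regular pairs from the Cohen–Macaulay condition -/

section Reduction

variable {R : Type*} [CommRing R]

theorem IsReductionOf.exists_mul_pow_eq {J I : Ideal R} (h : IsReductionOf J I) :
    ∃ r, ∀ k, r ≤ k → J * I ^ k = I ^ (k + 1) := by
  obtain ⟨-, r, hr⟩ := h
  refine ⟨r, fun k hk => ?_⟩
  obtain ⟨m, rfl⟩ := Nat.exists_eq_add_of_le hk
  rw [pow_add, ← mul_assoc, hr, ← pow_add]
  congr 1
  omega

theorem IsReductionOf.radical_eq {J I : Ideal R} (h : IsReductionOf J I) :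
    J.radical = I.radical := by
  refine le_antisymm (Ideal.radical_mono h.1) (Ideal.radical_le_radical_iff.mpr fun z hz => ?_)
  obtain ⟨-, r, hr⟩ := h
  refine ⟨r + 1, ?_⟩
  have := Ideal.pow_mem_pow hz (r + 1)
  rw [← hr] at this
  exact Ideal.mul_le_left this

end Reduction

theorem IsCohenMacaulayLocal.exists_isRegularPair {R : Type*} [CommRing R] [IsLocalRing R]
    (hCM : IsCohenMacaulayLocal R) (hdim : ringKrullDim R = 2) :
    ∃ a ∈ IsLocalRing.maximalIdeal R, ∃ b ∈ IsLocalRing.maximalIdeal R, IsRegularPair a b := by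
  obtain ⟨rs, hmem, hreg, hlen⟩ := hCM.exists_regular
  rw [hdim] at hlen
  have hlen' : rs.length = 2 := by exact_mod_cast hlen
  obtain ⟨a, b, rfl⟩ := List.length_eq_two.mp hlen'
  refine ⟨a, hmem a (by simp), b, hmem b (by simp), ?_, ?_⟩
  · intro z hz
    have := ((RingTheory.Sequence.isRegular_cons_iff R a [b]).mp hreg).1
    exact (isSMulRegular_iff_right_eq_zero_of_smul.mp this) z hz
  · intro c d hcd
    have h1 := ((RingTheory.Sequence.isRegular_cons_iff R a [b]).mp hreg).2
    have h2 := ((RingTheory.Sequence.isRegular_cons_iff _ b []).mp h1).1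
    have h3 := mem_of_isSMulRegular_quotient_of_smul_mem h2 (x := c)
      (by
        rw [smul_eq_mul, hcd]
        exact Submodule.smul_mem_pointwise_smul d a ⊤ trivial)
    obtain ⟨t, -, ht⟩ := (Submodule.mem_smul_pointwise_iff_exists _ _ _).mp h3
    exact ⟨t, ht.symm⟩

/-! ### Ratliff–Rush closures of a Hilbert filtration -/

namespace HilbertFiltration

variable {R : Type*} [CommRing R] [IsLocalRing R] (F : HilbertFiltration R)

/-- Beyond some degree p the filtration is I_{p+m} = I₁^m I_p, so the reduction equation for powers
of I₁ carries over. -/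
theorem exists_reduction_mul_eq {J : Ideal R} (hJ : IsReductionOf J (F.I 1)) :
    ∃ n₀, ∀ n, n₀ ≤ n → J * F.I n = F.I (n + 1) := by
  obtain ⟨r, hr⟩ := hJ.exists_mul_pow_eq
  obtain ⟨p, hp⟩ := F.good
  have key : ∀ m, F.I (p + m) = F.I 1 ^ m * F.I p := by
    intro m
    induction m with
    | zero => simp
    | succ m ih => rw [← add_assoc, ← hp _ (by omega), ih, ← mul_assoc, ← pow_succ']
  refine ⟨p + r, fun n hn => ?_⟩
  obtain ⟨m, rfl⟩ := Nat.exists_eq_add_of_le (show p ≤ n by omega)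
  rw [key, ← mul_assoc, hr m (by omega), add_assoc, key]

theorem one_pow_le (n : ℕ) : F.I 1 ^ n ≤ F.I n := by
  induction n with
  | zero => rw [F.zero_eq]; exact le_top
  | succ n ih =>
    rw [pow_succ]
    exact (Ideal.mul_mono_left ih).trans (F.mul_le n 1)

variable {F} {K J : Ideal R}

theorem mem_rr {n : ℕ} {z : R} :
    z ∈ F.rr K n ↔ ∃ k, 1 ≤ k ∧ ∀ s ∈ F.I 1 ^ k, z * s ∈ K * F.I (n + k) := by
  change (∃ k, 1 ≤ k ∧ z ∈ F.colonTerm K n k) ↔ _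
  simp only [colonTerm, Submodule.mem_colon, smul_eq_mul, SetLike.mem_coe]

theorem mul_le_mul_succ (hJ : J ≤ F.I 1) (n : ℕ) : J * (K * F.I n) ≤ K * F.I (n + 1) := by
  rw [mul_left_comm]
  refine Ideal.mul_mono_right ((Ideal.mul_mono_left hJ).trans ?_)
  rw [mul_comm]
  exact F.mul_le n 1

theorem mul_le_rr (n : ℕ) : K * F.I n ≤ F.rr K n := fun z hz =>
  mem_rr.mpr ⟨1, le_rfl, fun s hs => by
    rw [pow_one] at hs
    rw [mul_comm z s]
    exact mul_le_mul_succ le_rfl n (Ideal.mul_mem_mul hs hz)⟩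

theorem mul_rr_le (hJ : J ≤ F.I 1) (n : ℕ) : J * F.rr K n ≤ F.rr K (n + 1) := by
  rw [Ideal.mul_le]
  intro j hj z hz
  obtain ⟨k, hk, h⟩ := mem_rr.mp hz
  refine mem_rr.mpr ⟨k, hk, fun s hs => ?_⟩
  have := mul_le_mul_succ hJ _ (Ideal.mul_mem_mul hj (h s hs))
  rwa [mul_assoc, show n + 1 + k = n + k + 1 by ring]

/-- If xz and yz lie in rr_K(I_{n+1}), a common large exponent k serves both, and I₁^(k+1) = x I₁^k
+ y I₁^k; hence z I₁^(k+1) ⊆ K I_{n+1+k}. No bound on n is needed. -/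
theorem colon_rr_succ {x y : R} (hJxy : J = Ideal.span {x, y})
    (hJ : IsReductionOf J (F.I 1)) (n : ℕ) :
    Submodule.colon (F.rr K (n + 1)) (J : Set R) = F.rr K n := by
  obtain ⟨r, hr⟩ := hJ.exists_mul_pow_eq
  refine le_antisymm (fun z hz => ?_) fun z hz => ?_
  · rw [Submodule.mem_colon] at hz
    have hx := hz x (by rw [hJxy]; exact Ideal.subset_span (by simp))
    have hy := hz y (by rw [hJxy]; exact Ideal.subset_span (by simp))
    obtain ⟨k₁, hk₁, h1⟩ := hx
    obtain ⟨k₂, hk₂, h2⟩ := hy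
    have h1 := F.colonTerm_mono K (n + 1) (show k₁ ≤ k₁ + k₂ + r by omega) h1
    have h2 := F.colonTerm_mono K (n + 1) (show k₂ ≤ k₁ + k₂ + r by omega) h2
    refine mem_rr.mpr ⟨k₁ + k₂ + r + 1, by omega, fun s hs => ?_⟩
    rw [← hr _ (by omega), hJxy, Ideal.span_insert, Ideal.sup_mul] at hs
    obtain ⟨s₁, hs₁, s₂, hs₂, rfl⟩ := Submodule.mem_sup.mp hs
    obtain ⟨t₁, ht₁, rfl⟩ := Ideal.mem_span_singleton_mul.mp hs₁
    obtain ⟨t₂, ht₂, rfl⟩ := Ideal.mem_span_singleton_mul.mp hs₂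
    have e1 := Submodule.mem_colon.mp h1 t₁ ht₁
    have e2 := Submodule.mem_colon.mp h2 t₂ ht₂
    have := add_mem e1 e2
    rw [show n + (k₁ + k₂ + r + 1) = n + 1 + (k₁ + k₂ + r) by ring]
    simpa [mul_add, mul_assoc] using this
  · rw [Submodule.mem_colon]
    intro s hs
    rw [smul_eq_mul, mul_comm]
    exact mul_rr_le hJ.1 n (Ideal.mul_mem_mul hs hz)

/-- Multiplying z by I₁^k covers multiplying by J^k, which the colon hypothesis undoes one factor of
J at a time. -/
theorem exists_rr_eq {n₁ : ℕ} (hJ : J ≤ F.I 1)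
    (h : ∀ n, n₁ ≤ n → Submodule.colon (K * F.I (n + 1)) (J : Set R) = K * F.I n) :
    ∀ n, n₁ ≤ n → F.rr K n = K * F.I n := by
  refine fun n hn => le_antisymm (fun z hz => ?_) (mul_le_rr n)
  obtain ⟨k, -, hk⟩ := mem_rr.mp hz
  exact mem_of_forall_mul_pow_mem (M := fun n => K * F.I n) h k n hn z
    fun s hs => hk s (Ideal.pow_right_mono hJ k hs)

theorem one_pow_succ_le (hK : F.I 1 ≤ K) (n : ℕ) : F.I 1 ^ (n + 1) ≤ K * F.I n := by
  rw [pow_succ']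
  exact Ideal.mul_mono hK (F.one_pow_le n)

end HilbertFiltration

/-! ### Existence of the Hilbert coefficients -/

section Parameters

theorem IsRegularPair.lam_add_lam {R : Type*} [CommRing R] {J : Ideal R} {x y : R}
    (hxy : IsRegularPair x y) (hJxy : J = Ideal.span {x, y})
    {A : Ideal R} (hJA : Module.length R (R ⧸ J * A) ≠ ⊤)
    (hC : Module.length R (R ⧸ Submodule.colon A (J : Set R)) ≠ ⊤) :
    lam R (R ⧸ J * A) + lam R (R ⧸ Submodule.colon A (J : Set R)) =
      lam R (R ⧸ J) + 2 * lam R (R ⧸ A) := by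
  have h1 : Module.length R (R ⧸ J) ≠ ⊤ := length_quotient_ne_top_of_le Ideal.mul_le_left hJA
  have h2 : Module.length R (R ⧸ A) ≠ ⊤ := length_quotient_ne_top_of_le Ideal.mul_le_right hJA
  have h3 : Module.length R (R ⧸ A) + Module.length R (R ⧸ A) ≠ ⊤ := by simpa using h2
  subst hJxy
  have := congrArg ENat.toNat (hxy.length_add_length A)
  rwa [two_mul, ENat.toNat_add hJA hC,
    ENat.toNat_add h1 h3, ENat.toNat_add h2 h2, ← two_mul] at this

/-- The `J`-stable filtration `K I_n` is eventually closed under colons by `J`, and its Hilbert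
function is eventually a polynomial with leading coefficient `λ(R / J)`. -/
theorem HilbertFiltration.exists_coeffs {R : Type*} [CommRing R] [IsLocalRing R]
    [IsNoetherianRing R] {F : HilbertFiltration R} {K J : Ideal R} {x y : R}
    (hxy : IsRegularPair x y) (hJxy : J = Ideal.span {x, y}) (hJ : IsReductionOf J (F.I 1))
    (hfin : ∀ n, Module.length R (R ⧸ K * F.I n) ≠ ⊤) :
    (∃ n₁, ∀ n, n₁ ≤ n → F.rr K n = K * F.I n) ∧
    ∃ c : Fin 3 → ℤ, c 0 = lam R (R ⧸ J) ∧
      HasHilbertCoeffs (fun n => lam R (R ⧸ K * F.I n)) c := by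
  obtain ⟨n₀, hst⟩ := F.exists_reduction_mul_eq hJ
  have hst' : ∀ n, n₀ ≤ n → J * (K * F.I n) = K * F.I (n + 1) := fun n hn => by
    rw [mul_left_comm, hst n hn]
  have hxJ : x ∈ J := by rw [hJxy]; exact Ideal.subset_span (by simp)
  obtain ⟨n₁, hn₁⟩ := exists_colon_succ_eq_of_stable hxJ hxy.left (M := fun n => K * F.I n)
    (fun n => Ideal.mul_mono_right (F.anti n)) (mul_le_mul_succ hJ.1) hst'
  refine ⟨⟨n₁, exists_rr_eq hJ.1 hn₁⟩, exists_hasHilbertCoeffs (N := n₀ + n₁) fun n hn => ?_⟩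
  have hc : Submodule.colon (K * F.I (n + 1)) (J : Set R) = K * F.I n := hn₁ n (by omega)
  -- In this range both JA and A : J are terms of the filtration, so the length identity becomes a
  -- second-order recurrence.
  have := hxy.lam_add_lam hJxy (A := K * F.I (n + 1))
    (by rw [hst' (n + 1) (by omega)]; exact hfin _) (by rw [hc]; exact hfin _)
  rw [hst' (n + 1) (by omega), hc] at this
  zify at this
  linear_combination this

end Parameters

/-! ### The main statement -/

theorem proposition2p4 {R : Type*} [CommRing R] [IsLocalRing R]
    (hCM : IsCohenMacaulayLocal R) (hdim : ringKrullDim R = 2)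
    (F : HilbertFiltration R) (K : Ideal R) (hK : ∀ n, F.I (n + 1) ≤ K * F.I n)
    (J : Ideal R) (x y : R) (hJxy : J = Ideal.span {x, y})
    (hJ : IsMinimalReductionOf J (F.I 1)) :
    -- all the lengths that occur are finite, and the quotients `rr_K(I_n) / J rr_K(I_{n-1})`
    -- make sense
    (∀ n, Module.length R (R ⧸ F.I n) ≠ ⊤) ∧
    (∀ n, Module.length R (R ⧸ K * F.I n) ≠ ⊤) ∧
    (∀ n, Module.length R (R ⧸ F.rr K n) ≠ ⊤) ∧
    (∀ n, 1 ≤ n → J * F.rr K (n - 1) ≤ F.rr K n) ∧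
    (∀ n, 1 ≤ n →
      Module.length R (IdealQuot (F.rr K n) (J * F.rr K (n - 1))) ≠ ⊤) ∧
    -- the Hilbert polynomials `P(F, n)` and `P_K(F, n)` exist and are unique
    (∃! e : Fin 3 → ℤ, HasHilbertCoeffs (fun n => lam R (R ⧸ F.I n)) e) ∧
    (∃! g : Fin 3 → ℤ, HasHilbertCoeffs (fun n => lam R (R ⧸ K * F.I n)) g) ∧
    ∀ e g : Fin 3 → ℤ,
      HasHilbertCoeffs (fun n => lam R (R ⧸ F.I n)) e →
      HasHilbertCoeffs (fun n => lam R (R ⧸ K * F.I n)) g →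
      -- `λ(R / rr_K(I_n)) = P_K(F, n)` for all large `n`
      (∀ᶠ n in Filter.atTop, (lam R (R ⧸ F.rr K n) : ℤ) = hilbertPoly g n) ∧
      -- the analogue of the fundamental lemma
      (∀ n, 2 ≤ n →
        backwardDiff2 (fun m => hilbertPoly g m - lam R (R ⧸ F.rr K m)) n =
          lam R (IdealQuot (F.rr K n) (J * F.rr K (n - 1)))) ∧
      -- the formulas for `g₁` and `g₂`; the sums have only finitely many nonzero terms
      {n | vSeq F K J (e 0) n ≠ 0}.Finite ∧
      g 1 = (∑ᶠ (n : ℕ) (_ : 1 ≤ n), vSeq F K J (e 0) n) - lam R (R ⧸ F.rr K 0) ∧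
      g 2 = (∑ᶠ (n : ℕ) (_ : 1 ≤ n), ((n : ℤ) - 1) * vSeq F K J (e 0) n)
        + lam R (R ⧸ F.rr K 0) := by
  have := hCM.noetherian
  have hred : IsReductionOf J (F.I 1) := hJ.prop
  have hK₁ : F.I 1 ≤ K := (hK 0).trans Ideal.mul_le_left
  have hradJ : J.radical = IsLocalRing.maximalIdeal R := hred.radical_eq.trans F.radical_one
  obtain ⟨k, hk⟩ := Ideal.exists_pow_le_of_le_radical_of_fg hradJ.ge
    (IsNoetherian.noetherian (IsLocalRing.maximalIdeal R))
  have hyJ : y ∈ J := by rw [hJxy]; exact Ideal.subset_span (by simp)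
  have hxy : IsRegularPair x y := by
    obtain ⟨a, ha, b, hb, hab⟩ := hCM.exists_isRegularPair hdim
    exact hab.of_pow_mem (hJxy ▸ hk) ha hb (hradJ ▸ Ideal.le_radical hyJ)
  have hpow : ∀ n, IsLocalRing.maximalIdeal R ^ (k * n) ≤ J ^ n := fun n => by
    rw [pow_mul]; exact Ideal.pow_right_mono hk n
  have fin_of_pow_le : ∀ (A : Ideal R) (n : ℕ), J ^ n ≤ A → Module.length R (R ⧸ A) ≠ ⊤ :=
    fun A n h => length_quotient_ne_top_of_maximalIdeal_pow_le ((hpow n).trans h)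
  have hJK : ∀ n, J ^ (n + 1) ≤ K * F.I n := fun n =>
    (Ideal.pow_right_mono hred.1 _).trans (HilbertFiltration.one_pow_succ_le hK₁ n)
  have hJrr : ∀ n, J ^ (n + 1) ≤ F.rr K n := fun n =>
    (hJK n).trans (HilbertFiltration.mul_le_rr n)
  have finI : ∀ n, Module.length R (R ⧸ F.I n) ≠ ⊤ := fun n =>
    fin_of_pow_le _ n ((Ideal.pow_right_mono hred.1 n).trans (F.one_pow_le n))
  have finK : ∀ n, Module.length R (R ⧸ K * F.I n) ≠ ⊤ := fun n => fin_of_pow_le _ _ (hJK n)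
  have finrr : ∀ n, Module.length R (R ⧸ F.rr K n) ≠ ⊤ := fun n => fin_of_pow_le _ _ (hJrr n)
  have finJrr : ∀ n, Module.length R (R ⧸ J * F.rr K n) ≠ ⊤ := fun n =>
    fin_of_pow_le _ (n + 1 + 1) (by rw [pow_succ']; exact Ideal.mul_mono_right (hJrr n))
  have hle : ∀ n, J * F.rr K n ≤ F.rr K (n + 1) := HilbertFiltration.mul_rr_le hred.1
  -- K = R recovers λ(R/I_n) and gives e₀ = λ(R/J), which will also be g₀; this lets e₀ in the
  -- definition of v₁ be read as g₀.
  obtain ⟨-, e', he'₀, he'⟩ := HilbertFiltration.exists_coeffs (K := ⊤) hxy hJxy hred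
    (fun n => by rw [Ideal.top_mul]; exact finI n)
  have hI : ∀ n, lam R (R ⧸ (⊤ : Ideal R) * F.I n) = lam R (R ⧸ F.I n) := fun n => by
    rw [Ideal.top_mul]
  simp only [hI] at he'
  obtain ⟨⟨n₁, hrr⟩, g', hg'₀, hg'⟩ := HilbertFiltration.exists_coeffs hxy hJxy hred finK
  have hdiff : ∀ n, (lam R (IdealQuot (F.rr K (n + 2)) (J * F.rr K (n + 1))) : ℤ) =
      lam R (R ⧸ J) - ((lam R (R ⧸ F.rr K (n + 2)) : ℤ) - 2 * lam R (R ⧸ F.rr K (n + 1))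
        + lam R (R ⧸ F.rr K n)) := fun n => by
    have hc := HilbertFiltration.colon_rr_succ (K := K) hJxy hred n
    have h1 := hxy.lam_add_lam hJxy (finJrr (n + 1)) (by rw [hc]; exact finrr n)
    rw [hc] at h1
    have h2 := lam_quotient_eq_add (hle (n + 1)) (finJrr (n + 1))
    zify at h1 h2
    linear_combination h1 - h2
  refine ⟨finI, finK, finrr, ?_, ?_, ⟨e', he', fun _ h => h.unique he'⟩,
    ⟨g', hg', fun _ h => h.unique hg'⟩, fun e g he hg => ?_⟩
  · rintro (_ | n) hn
    · omega
    · exact hle n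
  · rintro (_ | n) hn
    · omega
    · exact length_idealQuot_ne_top (hle n) (finJrr n)
  obtain rfl := he.unique he'
  obtain rfl := hg.unique hg'
  have hev : ∀ᶠ n in Filter.atTop, (lam R (R ⧸ F.rr K n) : ℤ) = hilbertPoly g n := by
    filter_upwards [hg, Filter.eventually_ge_atTop n₁] with n hn hn₁
    rw [hrr n hn₁, hn]
  refine ⟨hev, ?_, ?_⟩
  · intro n hn
    obtain ⟨n, rfl⟩ := Nat.exists_eq_add_of_le' hn
    rw [backwardDiff2_hilbertPoly_sub g (fun m => (lam R (R ⧸ F.rr K m) : ℤ)), hg'₀]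
    exact (hdiff n).symm
  · refine hilbertCoeffs_eq_finsum (h := fun n => (lam R (R ⧸ F.rr K n) : ℤ)) hev ?_ fun n => ?_
    · rw [hg'₀, ← he'₀]
      rfl
    · rw [hg'₀]
      exact hdiff n
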